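/- Let $k$ be a field and let $\Delta$ be a simplicial complex with vertex set $[n]=\{1,\dots,n\}$ (so $\emptyset$ and every $\{v\}$, $v\in[n]$, are faces). Let $S=k[x_1,\dots,x_n]$, let $I_\Delta\subset S$ be the ideal generated by the monomials $\prod_{v\in F}x_v$ with $F\notin\Delta$, and let $k[\Delta]=S/I_\Delta$ be the face ring. Let $b_{i,j}$ denote the graded Betti numbers of $k[\Delta]$, that is, the minimal graded free resolution of $k[\Delta]$ over $S$ has $F_i=\bigoplus_j S(-j)^{b_{i,j}}$ in homological degree $i$. Put $t_i=\max\{j : b_{i,j}\neq 0\}$ (with $t_i=-\infty$ if $F_i=0$), let $r=\max_i(t_i-i)$ be the regularity of $k[\Delta]$, let $\mathit{lp}_j=\max\{i : b_{i,i+j-1}\neq 0\}$ (read as $0$ if there is no such $i$), and put $$m=\mathit{lp}_{r+1}=\max\{i : b_{i,i+r}\neq 0\},$$ the length of the last nonzero row of the Betti table. We say that $k[\Delta]$ has property $\mathfrak A$ if $\mathit{lp}_2\le m$ and $b_{m-i,\,m-i+1}\le b_{i,\,i+r-1}$ for all $0\le i\le m$. For an integer $s\ge 0$ we say that $k[\Delta]$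 has property $\mathfrak B_s$ if $t_i<r+i-1$ for all $0\le i<s$. **Theorem.** Suppose that $\Delta$ is $(d-1)$-dimensional with nontrivial top homology, $\widetilde H_{d-1}(\Delta;k)\neq 0$, and that $k[\Delta]$ has the properties $\mathfrak A$ and $\mathfrak B_s$. Then the underlying graph ($1$-skeleton) of $\Delta$ is $(d+s-1)$-connected. Here a graph is called $c$-connected if it has at least $c$ vertices and the removal of any set of fewer than $c$ vertices leaves a connected graph (when $d=s=0$, where $d+s-1=-1$, nothing is claimed). -/

import Mathlib

noncomputable section

namespace AbstractSimplicialComplex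

variable {n : ℕ} (Δ : AbstractSimplicialComplex (Fin n))

/-- Faces of `Δ` in the combinatorial convention: Mathlib's complexes list only the nonempty
faces, here the empty set is a face too. -/
def IsFace (F : Finset (Fin n)) : Prop := F = ∅ ∨ F ∈ Δ.faces

open Classical in
/-- The dimension: the largest cardinality of a face, minus one (`-1` for `{∅}`). -/
def dim : ℤ := ((Finset.univ.filter Δ.IsFace).sup Finset.card : ℕ) - 1

/-- The underlying graph (`1`-skeleton) of `Δ`. -/
def underlyingGraph : SimpleGraph (Fin n) where
  Adj u v := u ≠ v ∧ Δ.IsFace {u, v}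
  symm := ⟨fun u v h => ⟨h.1.symm, by rw [Finset.pair_comm]; exact h.2⟩⟩
  loopless := ⟨fun _ h => h.1 rfl⟩

/-- The Stanley–Reisner ideal: generated by the monomials `x_F` of the non-faces `F`. -/
def stanleyReisnerIdeal (k : Type*) [Field k] : Ideal (MvPolynomial (Fin n) k) :=
  Ideal.span {p | ∃ F : Finset (Fin n), ¬ Δ.IsFace F ∧ p = ∏ v ∈ F, MvPolynomial.X v}

section Homology

variable (k : Type*) [Field k]

/-- The `q`-dimensional faces (those with `q + 1` vertices), `q ≥ -1`. -/
def FaceOfDim (q : ℤ) : Type := {F : Finset (Fin n) // Δ.IsFace F ∧ (F.card : ℤ) = q + 1}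

instance (q : ℤ) : Finite (Δ.FaceOfDim q) := by
  unfold FaceOfDim; infer_instance

/-- The incidence number `[F : G]`: it is `(-1) ^ p` if `G` arises from `F` by deleting the `p`-th
vertex of `F` (counted from `0` in the order of the vertices), and `0` otherwise. -/
def incidence (F G : Finset (Fin n)) : k :=
  ∑ v ∈ F with F.erase v = G, (-1 : k) ^ (F.filter (· < v)).card

open Classical in
/-- The map from `p`-chains to `q`-chains with matrix the incidence numbers. For `q = p - 1` this is
the boundary operator of the augmented oriented simplicial chain complex. -/
def boundary (p q : ℤ) : (Δ.FaceOfDim p → k) →ₗ[k] (Δ.FaceOfDim q → k) :=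
  letI := Fintype.ofFinite (Δ.FaceOfDim p)
  { toFun := fun c G => ∑ F : Δ.FaceOfDim p, incidence k F.1 G.1 * c F
    map_add' := fun c c' => by
      funext G; simp [mul_add, Finset.sum_add_distrib]
    map_smul' := fun a c => by
      funext G; simp [Finset.mul_sum, mul_left_comm] }

/-- The reduced simplicial homology `H̃_q(Δ; k)`: cycles modulo boundaries. -/
abbrev ReducedHomology (q : ℤ) : Type _ :=
  LinearMap.ker (Δ.boundary k q (q - 1)) ⧸
    (LinearMap.range (Δ.boundary k (q + 1) q)).comap
      (LinearMap.ker (Δ.boundary k q (q - 1))).subtype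

end Homology

end AbstractSimplicialComplex

/-- `G` is `k`-connected: it has at least `k` vertices, and removing any set of fewer than `k`
vertices leaves a connected graph. -/
def SimpleGraph.IsVertexConnected {V : Type*} [Fintype V] (G : SimpleGraph V) (k : ℕ) : Prop :=
  k ≤ Fintype.card V ∧
    ∀ W : Finset V, W.card < k → (G.induce {v | v ∉ W}).Connected

/-- A minimal graded free resolution
`⋯ → F₂ → F₁ → F₀ → S/I → 0` of `S/I` over the polynomial ring `S = k[x_v | v ∈ σ]`, with
`F_i = ⨁ₐ S(-deg i a)`, the sum over `a < rank i`. -/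
structure MinimalGradedFreeResolution {σ k : Type*} [Field k]
    (I : Ideal (MvPolynomial σ k)) where
  /-- the rank of `F_i` -/
  rank : ℕ → ℕ
  /-- the degrees of the basis elements of `F_i` -/
  deg : (i : ℕ) → Fin (rank i) → ℕ
  /-- the differential `F_{i+1} → F_i` -/
  d : (i : ℕ) →
    (Fin (rank (i + 1)) → MvPolynomial σ k) →ₗ[MvPolynomial σ k] (Fin (rank i) → MvPolynomial σ k)
  /-- the augmentation `F_0 → S/I` -/
  aug : (Fin (rank 0) → MvPolynomial σ k) →ₗ[MvPolynomial σ k] (MvPolynomial σ k ⧸ I)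
  aug_surjective : Function.Surjective aug
  exact_aug : Function.Exact (d 0) aug
  exact_d : ∀ i, Function.Exact (d (i + 1)) (d i)
  /-- the augmentation is homogeneous of degree `0` -/
  aug_homogeneous : ∀ a, ∃ f : MvPolynomial σ k, f.IsHomogeneous (deg 0 a) ∧
    aug (Pi.single a 1) = Ideal.Quotient.mk I f
  /-- the differentials are homogeneous of degree `0`: every monomial in the `(b, a)` entry of the
  matrix of `d i` has degree `deg (i + 1) a - deg i b` -/
  d_homogeneous : ∀ i a b, ∀ u ∈ (d i (Pi.single a 1) b).support,
    u.degree + deg i b = deg (i + 1) a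
  /-- minimality: the entries of the matrices lie in the ideal generated by the variables -/
  minimal : ∀ i a b, d i (Pi.single a 1) b ∈
    Ideal.span (Set.range (MvPolynomial.X : σ → MvPolynomial σ k))

namespace MinimalGradedFreeResolution

variable {σ k : Type*} [Field k] {I : Ideal (MvPolynomial σ k)}
  (R : MinimalGradedFreeResolution I)

/-- The graded Betti number `b_{i,j}(S/I)`: the number of summands `S(-j)` of `F_i`. -/
def betti (i : ℕ) (j : ℤ) : ℕ := (Finset.univ.filter fun a => (R.deg i a : ℤ) = j).card

/-- `lp_j(S/I) = max {i | b_{i,i+j-1}(S/I) ≠ 0}`, read as `0` if there is no such `i`. -/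
def lp (j : ℤ) : ℕ := sSup {i : ℕ | R.betti i (i + j - 1) ≠ 0}

/-- `t_i(S/I) = max {j | b_{i,j}(S/I) ≠ 0}`, which is `⊥ = -∞` if `F_i = 0`. -/
def maxDegree (i : ℕ) : WithBot ℤ := Finset.univ.sup fun a => ((R.deg i a : ℤ) : WithBot ℤ)

/-- The regularity `max_i (t_i(S/I) - i)`. -/
def regularity : ℤ := sSup {q : ℤ | ∃ i : ℕ, R.maxDegree i = ((q + i : ℤ) : WithBot ℤ)}

/-- Property `𝔄`. With `r` the regularity, `m = max {i | b_{i,i+r} ≠ 0}` is the length of the last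
nonzero row of the Betti table; in the indexing of `lp` this row has number `r + 1`. -/
def PropertyA : Prop :=
  R.lp 2 ≤ R.lp (R.regularity + 1) ∧
    ∀ i i' : ℕ, i' + i = R.lp (R.regularity + 1) →
      R.betti i' (i' + 1) ≤ R.betti i (i + R.regularity - 1)

/-- Property `𝔅_s`: `t_i < r + i - 1` for all `i < s`, with `r` the regularity. -/
def PropertyB (s : ℕ) : Prop :=
  ∀ i < s, R.maxDegree i < ((R.regularity + i - 1 : ℤ) : WithBot ℤ)

end MinimalGradedFreeResolution

end

/-! By minimality of the resolution, $b_{p,j}=0$ exactly when the Koszul homology of $k[\Delta]$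
vanishes in homological degree $p$ and internal degree $j$
(`betti_eq_zero_iff_koszulAcyclicQuotient`), so explicit Koszul chains decide everything. This
homology lives in squarefree multidegrees, represented by terms $x_F e_\tau$ with $F$ a face
disjoint from $\tau$; hence $b_{p,j}=0$ for $j>n$ and for $j>p+d$.

Two fragments of Hochster's formula supply nonvanishing. A top cycle gives $b_{n-d,n}\neq 0$, which
with the bounds above forces $r=d$ and $m=n-d$. A disconnected induced subgraph on $p+1$ vertices
gives $b_{p,p+1}\neq 0$.

If deleting $W$ disconnects the graph, put $p+1=n-|W|$. Property $\mathfrak A$ gives $p\le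
\mathit{lp}_2\le m$ and $b_{m-p,\,m-p+r-1}\ge b_{p,p+1}>0$, so $t_{m-p}\ge r+(m-p)-1$. Property
$\mathfrak B_s$ then forces $m-p\ge s$, that is, $|W|\ge d+s-1$. -/

open MvPolynomial

/-! ### Exterior signs, division by a variable, and the Koszul homotopy -/

/-- The sign of `e_v ∧ e_τ` relative to `e_{τ ∪ {v}}`. -/
def koszulSign {σ : Type*} [LinearOrder σ] (v : σ) (τ : Finset σ) : ℤ :=
  (-1) ^ (τ.filter (· < v)).card

section KoszulSign

variable {σ : Type*} [LinearOrder σ]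

theorem koszulSign_mul_self (v : σ) (τ : Finset σ) : koszulSign v τ * koszulSign v τ = 1 := by
  rw [koszulSign, ← mul_pow]; simp

theorem koszulSign_insert {u v : σ} {τ : Finset σ} (hv : v ∉ τ) :
    koszulSign u (insert v τ) = (if v < u then -1 else 1) * koszulSign u τ := by
  unfold koszulSign
  rw [Finset.filter_insert]
  split_ifs with h
  · rw [Finset.card_insert_of_notMem (by simp [hv]), pow_succ]; ring
  · simp

theorem koszulSign_swap {u v : σ} {τ : Finset σ} (huv : u ≠ v) (hu : u ∉ τ) (hv : v ∉ τ) :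
    koszulSign v τ * koszulSign u (insert v τ) = -(koszulSign u τ * koszulSign v (insert u τ)) := by
  rw [koszulSign_insert hv, koszulSign_insert hu]
  rcases lt_or_gt_of_ne huv with h | h
  · rw [if_neg h.asymm, if_pos h]; ring
  · rw [if_pos h, if_neg h.asymm]; ring

end KoszulSign

section DivVar

variable {σ k : Type*} [CommRing k]

/-- The linear map sending a monomial `x ^ u` with `c < u v` to `x ^ u / x_v`, and the other
monomials to `0`. -/
noncomputable def divVar (c : ℕ) (v : σ) : MvPolynomial σ k →ₗ[k] MvPolynomial σ k where
  toFun f := monomial (Finsupp.single v c) 1 * f.divMonomial (Finsupp.single v (c + 1))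
  map_add' f g := by rw [add_divMonomial, mul_add]
  map_smul' a f := by
    ext u
    simp [coeff_monomial_mul']

theorem coeff_divVar (c : ℕ) (v : σ) (f : MvPolynomial σ k) (u : σ →₀ ℕ) :
    coeff u (divVar c v f) = if c ≤ u v then coeff (u + Finsupp.single v 1) f else 0 := by
  simp only [divVar, LinearMap.coe_mk, AddHom.coe_mk, coeff_monomial_mul', one_mul,
    coeff_divMonomial, Finsupp.single_le_iff]
  split_ifs with h
  · congr 1
    ext w
    by_cases hw : w = v
    · subst hw; simp; omega
    · simp [Ne.symm hw]
  · rfl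

/-- Division in the direction $v$ commutes with the other variables; this cancels the cross terms in
the homotopy formula. -/
theorem divVar_X_mul {c : ℕ} {u v : σ} (h : u ≠ v) (f : MvPolynomial σ k) :
    divVar c v (X u * f) = X u * divVar c v f := by
  classical
  ext w
  simp only [coeff_divVar, coeff_X_mul']
  have h1 : (w + Finsupp.single v 1 : σ →₀ ℕ) u = w u := by simp [h]
  have h2 : (w - Finsupp.single u 1 : σ →₀ ℕ) v = w v := by simp [h.symm]
  simp only [Finsupp.mem_support_iff, h1, h2]
  split_ifs with h3 h4 h4 <;> try rfl
  congr 1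
  ext x
  simp only [Finsupp.coe_add, Finsupp.coe_tsub, Pi.add_apply, Pi.sub_apply, Finsupp.single_apply]
  split_ifs with h5 h6 <;> try omega
  · exact absurd (h6.trans h5.symm) h

/-- The Koszul chain `f` is homogeneous of homological degree `p` and internal degree `j`, the
coefficient module being generated in degree `e`. -/
def KoszulHomogeneous (p e j : ℕ) (f : Finset σ → MvPolynomial σ k) : Prop :=
  ∀ τ u, coeff u (f τ) ≠ 0 → τ.card = p ∧ u.degree + e + p = j

theorem KoszulHomogeneous.add {p e j : ℕ} {f g : Finset σ → MvPolynomial σ k}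
    (hf : KoszulHomogeneous p e j f) (hg : KoszulHomogeneous p e j g) :
    KoszulHomogeneous p e j (f + g) := by
  intro τ u hu
  by_cases h : coeff u (f τ) = 0
  · exact hg τ u fun h' => hu (by rw [Pi.add_apply, coeff_add, h, h', add_zero])
  · exact hf τ u h

end DivVar

section Homotopy

variable {σ k : Type*} [LinearOrder σ] [CommRing k]

/-- Exterior multiplication by `e_v`, combined with division by `x_v`. -/
noncomputable def koszulHomotopy (c : ℕ) (v : σ) (f : Finset σ → MvPolynomial σ k) :
    Finset σ → MvPolynomial σ k := fun τ =>
  if v ∈ τ then koszulSign v (τ.erase v) • divVar c v (f (τ.erase v)) else 0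

/-- The multidegree of `x ^ u e_τ`. -/
noncomputable def koszulDegree (τ : Finset σ) (u : σ →₀ ℕ) (v : σ) : ℕ :=
  u v + if v ∈ τ then 1 else 0

theorem KoszulHomogeneous.koszulHomotopy {p e j : ℕ} {f : Finset σ → MvPolynomial σ k}
    (hf : KoszulHomogeneous p e j f) (c : ℕ) (v : σ) :
    KoszulHomogeneous (p + 1) e j (koszulHomotopy c v f) := by
  intro τ u hu
  rw [_root_.koszulHomotopy] at hu
  split_ifs at hu with hv
  · rw [coeff_smul, coeff_divVar] at hu
    split_ifs at hu with h
    · obtain ⟨h1, h2⟩ := hf (τ.erase v) _ (right_ne_zero_of_smul hu)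
      rw [Finset.card_erase_of_mem hv] at h1
      have := Finset.card_pos.2 ⟨v, hv⟩
      simp only [map_add, Finsupp.degree_single] at h2
      omega
    · simp at hu
  · simp at hu

end Homotopy

/-! ### The Koszul complex and its reduction to bounded multidegrees -/

section Koszul

variable {σ k : Type*} [Fintype σ] [LinearOrder σ] [CommRing k]
  {M N : Type*} [AddCommGroup M] [Module (MvPolynomial σ k) M]
  [AddCommGroup N] [Module (MvPolynomial σ k) N]

/-- The differential of the Koszul complex of the variables with coefficients in `M`; a chain is
given by its coefficients at the basis elements `e_τ`. -/
noncomputable def koszulD (σ k M : Type*) [Fintype σ] [LinearOrder σ] [CommRing k]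
    [AddCommGroup M] [Module (MvPolynomial σ k) M] :
    (Finset σ → M) →ₗ[MvPolynomial σ k] (Finset σ → M) where
  toFun f τ := ∑ v ∈ τᶜ, koszulSign v τ • (X v : MvPolynomial σ k) • f (insert v τ)
  map_add' f g := by
    funext τ; simp [smul_add, Finset.sum_add_distrib]
  map_smul' a f := by
    funext τ
    simp only [Pi.smul_apply, RingHom.id_apply, Finset.smul_sum]
    refine Finset.sum_congr rfl fun v _ => ?_
    rw [smul_comm a (koszulSign v τ), smul_comm a (X v : MvPolynomial σ k)]

theorem koszulD_apply (f : Finset σ → M) (τ : Finset σ) :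
    koszulD σ k M f τ =
      ∑ v ∈ τᶜ, koszulSign v τ • (X v : MvPolynomial σ k) • f (insert v τ) := rfl

theorem koszulD_comp (φ : M →ₗ[MvPolynomial σ k] N) (f : Finset σ → M) (τ : Finset σ) :
    koszulD σ k N (fun ρ => φ (f ρ)) τ = φ (koszulD σ k M f τ) := by
  simp only [koszulD_apply, map_sum, map_zsmul, map_smul]

theorem koszulD_pi {ι : Type*} (f : Finset σ → ι → MvPolynomial σ k) (τ : Finset σ) (a : ι) :
    koszulD σ k (ι → MvPolynomial σ k) f τ a = koszulD σ k _ (fun ρ => f ρ a) τ :=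
  (koszulD_comp (LinearMap.proj a) f τ).symm

theorem koszulD_mem (I : Submodule (MvPolynomial σ k) M) {f : Finset σ → M}
    (hf : ∀ τ, f τ ∈ I) (τ : Finset σ) : koszulD σ k M f τ ∈ I :=
  I.sum_mem fun _ _ => zsmul_mem (I.smul_mem _ (hf _)) _

/-- The terms removing $u$ and $v$ in the two possible orders cancel, by `koszulSign_swap`. -/
theorem koszulD_koszulD (f : Finset σ → M) : koszulD σ k M (koszulD σ k M f) = 0 := by
  funext τ
  simp only [koszulD_apply, Finset.smul_sum, Finset.sum_sigma', Pi.zero_apply]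
  refine Finset.sum_involution (fun p _ => ⟨p.2, p.1⟩) ?_ ?_ ?_ ?_
  · rintro ⟨v, u⟩ h
    simp only [Finset.mem_sigma, Finset.mem_compl, Finset.mem_insert, not_or] at h
    obtain ⟨hv, huv, hu⟩ := h
    simp only
    rw [Finset.insert_comm v u τ]
    have := koszulSign_swap huv hu hv
    simp only [smul_comm (X _ : MvPolynomial σ k) (koszulSign _ _), smul_smul]
    rw [this, mul_comm (X v : MvPolynomial σ k)]
    rw [neg_smul, neg_add_cancel]
  · rintro ⟨v, u⟩ h _ he
    simp only [Finset.mem_sigma, Finset.mem_compl, Finset.mem_insert, not_or] at h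
    simp only [Sigma.mk.injEq, heq_eq_eq] at he
    exact h.2.1 he.1
  · rintro ⟨v, u⟩ h
    simp only [Finset.mem_sigma, Finset.mem_compl, Finset.mem_insert, not_or] at h ⊢
    exact ⟨h.2.2, fun e => h.2.1 e.symm, h.1⟩
  · rintro ⟨v, u⟩ h; rfl

/-- The Koszul complex is the mapping cone of $x_v$ on the complex of the other variables. Division
inverts $x_v$ in multidegrees whose $v$-entry exceeds $c$, so $dh+hd$ is the identity there and zero
elsewhere. -/
theorem coeff_koszulHomotopy_formula (c : ℕ) (v : σ) (f : Finset σ → MvPolynomial σ k)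
    (τ : Finset σ) (u : σ →₀ ℕ) :
    coeff u (f τ - koszulD σ k _ (koszulHomotopy c v f) τ
      - koszulHomotopy c v (koszulD σ k _ f) τ) =
      if koszulDegree τ u v ≤ c then coeff u (f τ) else 0 := by
  by_cases hv : v ∈ τ
  · obtain ⟨ρ, hρ, rfl⟩ : ∃ ρ, v ∉ ρ ∧ τ = insert v ρ :=
      ⟨τ.erase v, by simp, (Finset.insert_erase hv).symm⟩
    have key : koszulD σ k _ (koszulHomotopy c v f) (insert v ρ)
        + koszulHomotopy c v (koszulD σ k _ f) (insert v ρ) =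
        divVar c v (X v * f (insert v ρ)) := by
      rw [koszulHomotopy, if_pos hv, Finset.erase_insert hρ]
      have hc : ρᶜ = insert v (insert v ρ)ᶜ := by
        ext x; by_cases hx : x = v <;> simp [hx, hρ]
      rw [koszulD_apply, koszulD_apply, hc, Finset.sum_insert (by simp), map_add, smul_add,
        map_zsmul, smul_smul, koszulSign_mul_self, one_smul, map_sum, Finset.smul_sum,
        add_left_comm, ← Finset.sum_add_distrib, Finset.sum_eq_zero, add_zero, smul_eq_mul]
      intro w hw
      simp only [Finset.mem_compl, Finset.mem_insert, not_or] at hw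
      have e : (insert w (insert v ρ)).erase v = insert w ρ := by
        rw [Finset.insert_comm, Finset.erase_insert]; simp [hρ, Ne.symm hw.1]
      rw [koszulHomotopy, if_pos (by simp), e, map_zsmul, smul_eq_mul, smul_eq_mul,
        divVar_X_mul hw.1, mul_smul_comm, smul_smul, smul_smul, ← add_smul]
      have h1 := koszulSign_insert (u := w) hρ
      have h2 := koszulSign_insert (u := v) hw.2
      have h3 : koszulSign w (insert v ρ) * koszulSign v (insert w ρ) +
          koszulSign v ρ * koszulSign w ρ = 0 := by
        rcases lt_or_gt_of_ne hw.1 with h | h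
        · rw [h1, h2, if_neg h.asymm, if_pos h]; ring
        · rw [h1, h2, if_pos h, if_neg h.asymm]; ring
      rw [h3, zero_smul]
    rw [sub_sub, key, coeff_sub, coeff_divVar, add_comm u, coeff_X_mul, koszulDegree, if_pos hv]
    by_cases h : c ≤ u v
    · rw [if_pos h, if_neg (by omega), sub_self]
    · rw [if_neg h, if_pos (by omega), sub_zero]
  · have h1 : koszulHomotopy c v (koszulD σ k _ f) τ = 0 := if_neg hv
    have h2 : koszulD σ k _ (koszulHomotopy c v f) τ = X v * divVar c v (f τ) := by
      rw [koszulD_apply, Finset.sum_eq_single v]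
      · rw [koszulHomotopy, if_pos (by simp), Finset.erase_insert hv, smul_eq_mul, mul_smul_comm,
          smul_smul, koszulSign_mul_self, one_smul]
      · intro w _ hw
        rw [koszulHomotopy, if_neg (by simp [hv, hw.symm]), smul_zero, smul_zero]
      · simp [hv]
    rw [h1, h2, sub_zero, coeff_sub, coeff_X_mul', koszulDegree, if_neg hv, add_zero]
    by_cases h0 : u v = 0
    · rw [if_neg (by simpa using h0), if_pos (by omega), sub_zero]
    · have e : u - Finsupp.single v 1 + Finsupp.single v 1 = u :=
        tsub_add_cancel_of_le (by rw [Finsupp.single_le_iff]; omega)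
      rw [if_pos (by simpa using h0), coeff_divVar, e]
      simp only [Finsupp.coe_tsub, Pi.sub_apply, Finsupp.single_eq_same]
      by_cases h : u v ≤ c
      · rw [if_neg (by omega), if_pos h, sub_zero]
      · rw [if_pos (by omega), if_neg h, sub_self]

/-- Modulo boundaries and modulo an ideal stable under `divVar c`, a homogeneous Koszul cycle can
be replaced by the part of it in the multidegrees bounded by `c`. -/
theorem exists_koszul_reduction (c : ℕ) (I : Ideal (MvPolynomial σ k))
    (hI : ∀ v, ∀ f ∈ I, divVar c v f ∈ I) (z : Finset σ → MvPolynomial σ k)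
    (hdz : ∀ τ, koszulD σ k _ z τ ∈ I) (T : Finset σ) :
    ∃ w z' : Finset σ → MvPolynomial σ k,
      (∀ p e j, KoszulHomogeneous p e j z → KoszulHomogeneous (p + 1) e j w) ∧
      (∀ τ, koszulD σ k _ z' τ ∈ I) ∧ (∀ τ, z τ - koszulD σ k _ w τ - z' τ ∈ I) ∧
      ∀ τ u, coeff u (z' τ) =
        if ∀ v ∈ T, koszulDegree τ u v ≤ c then coeff u (z τ) else 0 := by
  induction T using Finset.induction_on with
  | empty =>
    refine ⟨0, z, fun _ _ _ _ τ u h => by simp at h, hdz, fun τ => by simp, fun τ u => by simp⟩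
  | insert v T hv ih =>
    obtain ⟨w, z', hw, hdz', hzz', hc⟩ := ih
    have hz' : ∀ p e j, KoszulHomogeneous p e j z → KoszulHomogeneous p e j z' := by
      intro p e j hz τ u hu
      rw [hc] at hu
      split_ifs at hu
      · exact hz τ u hu
      · exact absurd rfl hu
    have hh : ∀ τ, koszulHomotopy c v (koszulD σ k _ z') τ ∈ I := by
      intro τ
      rw [koszulHomotopy]
      split_ifs
      · exact zsmul_mem (hI _ _ (hdz' _)) _
      · exact I.zero_mem
    -- Projecting in one further direction changes $z'$ by the boundary $d(hz')$ and by $h(dz')$;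
    -- the latter stays in $I$ because $I$ is stable under division.
    refine ⟨w + koszulHomotopy c v z', fun τ => z' τ - koszulD σ k _ (koszulHomotopy c v z') τ
      - koszulHomotopy c v (koszulD σ k _ z') τ, 
      fun p e j hz => (hw p e j hz).add ((hz' p e j hz).koszulHomotopy c v), ?_, ?_, ?_⟩
    · intro τ
      change koszulD σ k _ (z' - koszulD σ k _ (koszulHomotopy c v z')
        - koszulHomotopy c v (koszulD σ k _ z')) τ ∈ I
      rw [map_sub, map_sub, koszulD_koszulD, sub_zero]
      exact sub_mem (hdz' τ) (koszulD_mem I hh τ)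
    · intro τ
      rw [map_add, Pi.add_apply]
      have : z τ - (koszulD σ k _ w τ + koszulD σ k _ (koszulHomotopy c v z') τ) -
          (z' τ - koszulD σ k _ (koszulHomotopy c v z') τ
            - koszulHomotopy c v (koszulD σ k _ z') τ) =
          (z τ - koszulD σ k _ w τ - z' τ) + koszulHomotopy c v (koszulD σ k _ z') τ := by
        ring
      rw [this]
      exact add_mem (hzz' τ) (hh τ)
    · intro τ u
      rw [coeff_koszulHomotopy_formula, hc]
      by_cases h1 : koszulDegree τ u v ≤ c <;> simp [h1]

/-- The Koszul complex of the polynomial ring is exact except for the constants. -/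
theorem exists_koszulD_eq (z : Finset σ → MvPolynomial σ k) (hdz : koszulD σ k _ z = 0)
    (h0 : coeff 0 (z ∅) = 0) :
    ∃ w, koszulD σ k _ w = z ∧
      ∀ p e j, KoszulHomogeneous p e j z → KoszulHomogeneous (p + 1) e j w := by
  obtain ⟨w, z', hw, -, h, hc⟩ := exists_koszul_reduction 0 ⊥ (fun v f hf => by
    rw [Ideal.mem_bot] at hf ⊢; rw [hf, map_zero]) z (fun τ => by rw [hdz]; simp) Finset.univ
  refine ⟨w, funext fun τ => ?_, hw⟩
  have hz' : z' τ = 0 := by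
    ext u
    rw [hc, coeff_zero]
    -- For $c=0$ only multidegree $0$ survives, where the chain is the constant at $e_\emptyset$,
    -- excluded by `h0`.
    split_ifs with hT
    · have hτ : τ = ∅ := by
        by_contra hne
        obtain ⟨v, hv⟩ := Finset.nonempty_iff_ne_empty.2 hne
        have := hT v (Finset.mem_univ v)
        simp [koszulDegree, hv] at this
      have hu : u = 0 := by
        ext v
        have := hT v (Finset.mem_univ v)
        simp only [koszulDegree] at this
        simp only [Finsupp.coe_zero, Pi.zero_apply]
        omega
      rw [hτ, hu, h0]
    · rfl
  have := h τ
  rw [Ideal.mem_bot, hz', sub_zero, sub_eq_zero] at this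
  exact this.symm

end Koszul

/-! ### Homogeneous parts of polynomials and Koszul chains -/

section DegreePart

variable {σ k : Type*} [CommRing k]

/-- The part of `f` in degree `m`, where `1` has degree `e`. -/
noncomputable def degreePart (e m : ℕ) (f : MvPolynomial σ k) : MvPolynomial σ k :=
  if e ≤ m then homogeneousComponent (m - e) f else 0

theorem coeff_degreePart (e m : ℕ) (f : MvPolynomial σ k) (u : σ →₀ ℕ) :
    coeff u (degreePart e m f) = if u.degree + e = m then coeff u f else 0 := by
  unfold degreePart
  split_ifs with h1 h2 h2
  · rw [coeff_homogeneousComponent, if_pos (by omega)]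
  · rw [coeff_homogeneousComponent, if_neg (by omega)]
  · omega
  · rfl

theorem degreePart_sub (e m : ℕ) (f g : MvPolynomial σ k) :
    degreePart e m (f - g) = degreePart e m f - degreePart e m g := by
  ext u
  simp only [coeff_sub, coeff_degreePart]
  split_ifs <;> simp

theorem degreePart_sum {ι : Type*} (s : Finset ι) (e m : ℕ) (f : ι → MvPolynomial σ k) :
    degreePart e m (∑ i ∈ s, f i) = ∑ i ∈ s, degreePart e m (f i) := by
  ext u
  simp only [coeff_sum, coeff_degreePart]
  split_ifs <;> simp

theorem degreePart_mul {e e' m : ℕ} (f : MvPolynomial σ k) {g : MvPolynomial σ k}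
    (hg : ∀ u ∈ g.support, u.degree + e' = e) :
    degreePart e' m (f * g) = degreePart e m f * g := by
  classical
  ext u
  rw [coeff_degreePart, coeff_mul, coeff_mul]
  by_cases hu : u.degree + e' = m
  · rw [if_pos hu]
    refine Finset.sum_congr rfl fun x hx => ?_
    rw [coeff_degreePart]
    by_cases h : coeff x.2 g = 0
    · rw [h, mul_zero, mul_zero]
    · have h1 := hg x.2 (mem_support_iff.2 h)
      have h2 := congrArg Finsupp.degree (Finset.HasAntidiagonal.mem_antidiagonal.1 hx)
      rw [map_add] at h2
      rw [if_pos (by omega)]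
  · rw [if_neg hu]
    refine (Finset.sum_eq_zero fun x hx => ?_).symm
    rw [coeff_degreePart]
    by_cases h : coeff x.2 g = 0
    · rw [h, mul_zero]
    · have h1 := hg x.2 (mem_support_iff.2 h)
      have h2 := congrArg Finsupp.degree (Finset.HasAntidiagonal.mem_antidiagonal.1 hx)
      rw [map_add] at h2
      rw [if_neg (by omega), zero_mul]

theorem apply_eq_sum_mul {ι : Type*} [Fintype ι] [DecidableEq ι]
    (φ : (ι → MvPolynomial σ k) →ₗ[MvPolynomial σ k] MvPolynomial σ k)
    (y : ι → MvPolynomial σ k) : φ y = ∑ a, y a * φ (Pi.single a 1) := by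
  conv_lhs => rw [← Finset.univ_sum_single y]
  rw [map_sum]
  refine Finset.sum_congr rfl fun a _ => ?_
  rw [← smul_eq_mul, ← map_smul, ← Pi.single_smul, smul_eq_mul, mul_one]

theorem degreePart_apply {ι : Type*} [Fintype ι] [DecidableEq ι] {deg : ι → ℕ} {e : ℕ}
    {φ : (ι → MvPolynomial σ k) →ₗ[MvPolynomial σ k] MvPolynomial σ k}
    (hφ : ∀ a, ∀ u ∈ (φ (Pi.single a 1)).support, u.degree + e = deg a) (p m : ℕ)
    (y : ι → MvPolynomial σ k) :
    degreePart (e + p) m (φ y) = φ (fun a => degreePart (deg a + p) m (y a)) := by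
  rw [apply_eq_sum_mul, apply_eq_sum_mul φ (fun a => _), degreePart_sum]
  refine Finset.sum_congr rfl fun a _ => degreePart_mul _ fun u hu => ?_
  rw [← hφ a u hu, add_assoc]

/-- The part of a Koszul chain in homological degree `p` and internal degree `j`. -/
noncomputable def chainPart (p e j : ℕ) (f : Finset σ → MvPolynomial σ k) :
    Finset σ → MvPolynomial σ k :=
  fun τ => if τ.card = p then degreePart (e + p) j (f τ) else 0

theorem chainPart_sub (p e j : ℕ) (f g : Finset σ → MvPolynomial σ k) :
    chainPart p e j (f - g) = chainPart p e j f - chainPart p e j g := by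
  funext τ
  simp only [chainPart, Pi.sub_apply]
  split_ifs
  · exact degreePart_sub _ _ _ _
  · exact (sub_zero 0).symm

theorem koszulHomogeneous_chainPart (p e j : ℕ) (f : Finset σ → MvPolynomial σ k) :
    KoszulHomogeneous p e j (chainPart p e j f) := by
  intro τ u hu
  unfold chainPart at hu
  split_ifs at hu with h
  · rw [coeff_degreePart] at hu
    split_ifs at hu with h'
    · exact ⟨h, by omega⟩
    · exact absurd rfl hu
  · exact absurd rfl hu

theorem KoszulHomogeneous.chainPart_eq {p e j : ℕ} {f : Finset σ → MvPolynomial σ k}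
    (hf : KoszulHomogeneous p e j f) : chainPart p e j f = f := by
  funext τ
  ext u
  by_cases h : coeff u (f τ) = 0
  · unfold chainPart
    split_ifs with h1
    · rw [coeff_degreePart, h, ite_self]
    · rw [h, coeff_zero]
  · obtain ⟨h1, h2⟩ := hf τ u h
    rw [chainPart, if_pos h1, coeff_degreePart, if_pos (by omega)]

/-- Truncation commutes with degree-preserving maps, so arbitrary lifts of homogeneous chains can be
replaced by homogeneous ones. -/
theorem chainPart_apply {ι : Type*} [Fintype ι] [DecidableEq ι] {deg : ι → ℕ} {e : ℕ}
    {φ : (ι → MvPolynomial σ k) →ₗ[MvPolynomial σ k] MvPolynomial σ k}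
    (hφ : ∀ a, ∀ u ∈ (φ (Pi.single a 1)).support, u.degree + e = deg a) (p j : ℕ)
    (y : Finset σ → ι → MvPolynomial σ k) :
    chainPart p e j (fun τ => φ (y τ)) =
      fun τ => φ (fun a => chainPart p (deg a) j (fun ρ => y ρ a) τ) := by
  funext τ
  unfold chainPart
  split_ifs
  · exact degreePart_apply hφ p j (y τ)
  · exact (map_zero φ).symm

theorem KoszulHomogeneous.apply {ι : Type*} [Fintype ι] [DecidableEq ι] {deg : ι → ℕ} {e : ℕ}
    {φ : (ι → MvPolynomial σ k) →ₗ[MvPolynomial σ k] MvPolynomial σ k}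
    (hφ : ∀ a, ∀ u ∈ (φ (Pi.single a 1)).support, u.degree + e = deg a) {p j : ℕ}
    {y : Finset σ → ι → MvPolynomial σ k}
    (hy : ∀ a, KoszulHomogeneous p (deg a) j fun τ => y τ a) :
    KoszulHomogeneous p e j fun τ => φ (y τ) := by
  have := chainPart_apply hφ p j y
  simp only [fun a => (hy a).chainPart_eq] at this
  rw [← this]
  exact koszulHomogeneous_chainPart _ _ _ _

end DegreePart

/-! ### Koszul homology and dimension shifting -/

section Acyclic

variable {σ k : Type*} [Fintype σ] [LinearOrder σ] [CommRing k]

theorem exists_koszulD_pi_eq {ι : Type*} (z : Finset σ → ι → MvPolynomial σ k)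
    (hdz : koszulD σ k _ z = 0) (h0 : ∀ a, coeff 0 (z ∅ a) = 0) :
    ∃ w, koszulD σ k _ w = z ∧ ∀ a p e j, KoszulHomogeneous p e j (fun τ => z τ a) →
      KoszulHomogeneous (p + 1) e j (fun τ => w τ a) := by
  have (a : ι) := exists_koszulD_eq (fun τ => z τ a) (by
    funext τ; rw [← koszulD_pi, hdz]; rfl) (h0 a)
  choose w hw hw' using this
  refine ⟨fun τ a => w a τ, ?_, hw'⟩
  funext τ a
  rw [koszulD_pi]
  exact congrFun (hw a) τ

/-- The Koszul homology of `F / N`, with `F` free on generators of degrees `deg`, vanishes in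
homological degree `p` and internal degree `j`. -/
def KoszulAcyclic {ι : Type*} (deg : ι → ℕ)
    (N : Submodule (MvPolynomial σ k) (ι → MvPolynomial σ k)) (p j : ℕ) : Prop :=
  ∀ z : Finset σ → ι → MvPolynomial σ k,
    (∀ a, KoszulHomogeneous p (deg a) j fun τ => z τ a) → (∀ τ, koszulD σ k _ z τ ∈ N) →
      ∃ w, ∀ τ, z τ - koszulD σ k _ w τ ∈ N

/-- The Koszul homology of `S / I` vanishes in homological degree `p` and internal degree `j`. -/
def KoszulAcyclicQuotient (I : Ideal (MvPolynomial σ k)) (p j : ℕ) : Prop :=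
  ∀ z : Finset σ → MvPolynomial σ k, KoszulHomogeneous p 0 j z → (∀ τ, koszulD σ k _ z τ ∈ I) →
    ∃ w, ∀ τ, z τ - koszulD σ k _ w τ ∈ I

/-- Let $\varphi:F\to F'$. This is the connecting map of $0\to\operatorname{im}\varphi\to F'\to
F'/\operatorname{im}\varphi\to0$, with $\operatorname{im}\varphi\cong F/\ker\varphi$. It is an
isomorphism since $F'$ has no Koszul homology in positive degrees and `h0` makes
$H_0(\operatorname{im}\varphi)\to H_0(F')$ zero. -/
theorem koszulAcyclic_range_iff_ker {ι ι' : Type*} [Fintype ι] [DecidableEq ι] {deg : ι → ℕ}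
    {deg' : ι' → ℕ}
    (φ : (ι → MvPolynomial σ k) →ₗ[MvPolynomial σ k] (ι' → MvPolynomial σ k))
    (hφ : ∀ a b, ∀ u ∈ (φ (Pi.single a 1) b).support, u.degree + deg' b = deg a)
    (h0 : ∀ y b, coeff 0 (φ y b) = 0) (p j : ℕ) :
    KoszulAcyclic deg' (LinearMap.range φ) (p + 1) j ↔ KoszulAcyclic deg (LinearMap.ker φ) p j := by
  have hφ' (b) : ∀ a, ∀ u ∈ ((LinearMap.proj b ∘ₗ φ) (Pi.single a 1)).support,
      u.degree + deg' b = deg a := fun a => hφ a b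
  constructor
  · intro H y hy hdy
    -- The cycle $\varphi(y)$ bounds in $F'$; a chain it bounds is a preimage under the connecting
    -- map.
    obtain ⟨z, hz, hzh⟩ := exists_koszulD_pi_eq (fun τ => φ (y τ))
      (by funext τ; rw [koszulD_comp]; exact hdy τ) (fun b => h0 _ b)
    obtain ⟨w, hw⟩ := H z (fun b => hzh b p (deg' b) j (KoszulHomogeneous.apply (hφ' b) hy))
      (fun τ => by rw [hz]; exact ⟨_, rfl⟩)
    choose u hu using hw
    refine ⟨u, fun τ => ?_⟩
    rw [LinearMap.mem_ker, map_sub, ← koszulD_comp, sub_eq_zero]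
    have : (fun ρ => φ (u ρ)) = z - koszulD σ k _ w := funext fun ρ => hu ρ
    rw [this, map_sub, koszulD_koszulD, sub_zero, hz]
  · intro H z hz hdz
    choose y' hy' using hdz
    have hdz' : ∀ b, KoszulHomogeneous p (deg' b) j fun τ => koszulD σ k _ z τ b := by
      intro b τ u hu
      simp only [koszulD_pi, koszulD_apply, coeff_sum] at hu
      obtain ⟨v, hv, hne⟩ := Finset.exists_ne_zero_of_sum_ne_zero hu
      rw [coeff_smul, smul_eq_mul, coeff_X_mul'] at hne
      split_ifs at hne with h
      · obtain ⟨h1, h2⟩ := hz b _ _ (right_ne_zero_of_smul hne)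
        rw [Finset.card_insert_of_notMem (Finset.mem_compl.1 hv)] at h1
        have h3 : u = (u - Finsupp.single v 1) + Finsupp.single v 1 :=
          (tsub_add_cancel_of_le (by
            rw [Finsupp.single_le_iff]; exact Nat.one_le_iff_ne_zero.2 (by simpa using h))).symm
        have h4 : u.degree = (u - Finsupp.single v 1).degree + 1 := by
          conv_lhs => rw [h3, map_add, Finsupp.degree_single]
        omega
      · simp at hne
    -- The chosen lifts `y'` need not be homogeneous; their part in the right bidegree still maps to
    -- $dz$.
    set y : Finset σ → ι → MvPolynomial σ k :=
      fun τ a => chainPart p (deg a) j (fun ρ => y' ρ a) τ with hy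
    have hyz : ∀ τ, φ (y τ) = koszulD σ k _ z τ := by
      intro τ
      funext b
      have := congrFun (chainPart_apply (hφ' b) p j y') τ
      refine this.symm.trans (Eq.trans ?_ (congrFun (hdz' b).chainPart_eq τ))
      simp only [← hy']
      rfl
    obtain ⟨w, hw⟩ := H y (fun a => koszulHomogeneous_chainPart _ _ _ _) (fun τ => by
      rw [LinearMap.mem_ker, ← koszulD_comp]
      simp only [hyz]
      exact congrFun (koszulD_koszulD z) τ)
    -- The chain $z-\varphi(w)$ is a cycle of $F'$ without constant term, hence a boundary.
    obtain ⟨v, hv, -⟩ := exists_koszulD_pi_eq (z - fun τ => φ (w τ)) (by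
      rw [map_sub, sub_eq_zero]
      funext τ
      have := hw τ
      rw [LinearMap.mem_ker, map_sub, sub_eq_zero, hyz] at this
      rw [this, koszulD_comp]) (fun b => by
        rw [Pi.sub_apply, Pi.sub_apply, coeff_sub, h0, sub_zero]
        by_contra hne
        have := (hz b ∅ 0 hne).1
        simp at this)
    refine ⟨v, fun τ => ⟨w τ, ?_⟩⟩
    rw [hv]
    simp

/-- As $N\subseteq\mathfrak mF$, the zeroth Koszul homology of $F/N$ is $F/\mathfrak mF$, with one
class for each basis element. -/
theorem koszulAcyclic_zero_iff [Nontrivial k] {ι : Type*} [DecidableEq ι] {deg : ι → ℕ}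
    {N : Submodule (MvPolynomial σ k) (ι → MvPolynomial σ k)}
    (hN : ∀ y ∈ N, ∀ a, coeff 0 (y a) = 0) (j : ℕ) :
    KoszulAcyclic deg N 0 j ↔ ∀ a, deg a ≠ j := by
  constructor
  · rintro H a rfl
    obtain ⟨w, hw⟩ := H (fun τ => if τ = ∅ then Pi.single a 1 else 0) (by
      intro b τ u hu
      change coeff u ((if τ = ∅ then (Pi.single a 1 : ι → MvPolynomial σ k) else 0) b) ≠ 0 at hu
      split_ifs at hu with h
      · subst h
        by_cases hb : b = a
        · subst hb
          rw [Pi.single_eq_same, coeff_one] at hu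
          split_ifs at hu with h'
          · simp [← h']
          · exact absurd rfl hu
        · rw [Pi.single_eq_of_ne hb] at hu
          exact absurd rfl hu
      · exact absurd rfl hu) (fun τ => by
        rw [koszulD_apply, Finset.sum_eq_zero]
        · exact N.zero_mem
        · intro v _
          simp)
    have := hN _ (hw ∅) a
    rw [Pi.sub_apply, coeff_sub, koszulD_pi, koszulD_apply, coeff_sum, Finset.sum_eq_zero] at this
    · simp at this
    · intro v _
      rw [coeff_smul, smul_eq_mul, coeff_X_mul', if_neg (by simp), smul_zero]
  · intro H z hz hdz
    obtain ⟨w, hw, -⟩ := exists_koszulD_pi_eq z (by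
      funext τ
      refine Finset.sum_eq_zero fun v _ => ?_
      have : z (insert v τ) = 0 := by
        funext a
        ext u
        by_contra hne
        have := (hz a _ u hne).1
        simp at this
      rw [this, smul_zero, smul_zero]) (fun a => by
        by_contra hne
        have := (hz a ∅ 0 hne).2
        exact H a (by simpa using this))
    exact ⟨w, fun τ => by rw [hw, sub_self]; exact N.zero_mem⟩

/-- Here $\varphi$ induces an isomorphism $F/\varphi^{-1}(I)\cong S/I$; this moves the homology of
$S/I$ to the cokernel of the first differential. -/
theorem koszulAcyclicQuotient_iff {ι : Type*} [Fintype ι] [DecidableEq ι] {deg : ι → ℕ}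
    (I : Ideal (MvPolynomial σ k)) (hI : ∀ f ∈ I, ∀ e m, degreePart e m f ∈ I)
    (φ : (ι → MvPolynomial σ k) →ₗ[MvPolynomial σ k] MvPolynomial σ k)
    (hφ : ∀ a, ∀ u ∈ (φ (Pi.single a 1)).support, u.degree + 0 = deg a)
    (hsurj : ∀ f, ∃ y, f - φ y ∈ I) (p j : ℕ) :
    KoszulAcyclicQuotient I p j ↔ KoszulAcyclic deg (Submodule.comap φ I) p j := by
  choose s hs using hsurj
  constructor
  · intro H z hz hdz
    obtain ⟨w, hw⟩ := H (fun τ => φ (z τ)) (KoszulHomogeneous.apply hφ hz)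
      (fun τ => by rw [koszulD_comp]; exact hdz τ)
    refine ⟨fun τ => s (w τ), fun τ => ?_⟩
    rw [Submodule.mem_comap, map_sub, ← koszulD_comp]
    have h1 := koszulD_mem I (fun ρ => hs (w ρ)) τ
    have h2 : koszulD σ k _ (fun ρ => w ρ - φ (s (w ρ))) τ =
      koszulD σ k _ w τ - koszulD σ k _ (fun ρ => φ (s (w ρ))) τ :=
      congrFun (map_sub (koszulD σ k _) w _) τ
    rw [h2] at h1
    have := add_mem (hw τ) h1
    rwa [sub_add_sub_cancel] at this
  · intro H z hz hdz
    set y : Finset σ → ι → MvPolynomial σ k :=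
      fun τ a => chainPart p (deg a) j (fun ρ => s (z ρ) a) τ
    have hyz : ∀ τ, z τ - φ (y τ) ∈ I := by
      intro τ
      have h1 := congrFun (chainPart_apply hφ p j (fun ρ => s (z ρ))) τ
      have h2 := congrFun (chainPart_sub p 0 j z (fun ρ => φ (s (z ρ)))) τ
      rw [Pi.sub_apply, h1, hz.chainPart_eq] at h2
      change _ = z τ - φ (y τ) at h2
      rw [← h2]
      unfold chainPart
      split_ifs
      · exact hI _ (hs (z τ)) _ _
      · exact I.zero_mem
    obtain ⟨w, hw⟩ := H y (fun a => koszulHomogeneous_chainPart _ _ _ _) (fun τ => by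
      rw [Submodule.mem_comap, ← koszulD_comp]
      have h1 := koszulD_mem I hyz τ
      have h2 : koszulD σ k _ (fun ρ => z ρ - φ (y ρ)) τ =
        koszulD σ k _ z τ - koszulD σ k _ (fun ρ => φ (y ρ)) τ :=
        congrFun (map_sub (koszulD σ k _) z _) τ
      rw [h2] at h1
      have := sub_mem (hdz τ) h1
      rwa [sub_sub_cancel] at this)
    refine ⟨fun τ => φ (w τ), fun τ => ?_⟩
    have h1 := hw τ
    rw [Submodule.mem_comap, map_sub, ← koszulD_comp] at h1
    have := add_mem (hyz τ) h1
    rwa [sub_add_sub_cancel] at this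

end Acyclic

/-! ### Betti numbers read off from Koszul homology -/

namespace MinimalGradedFreeResolution

variable {σ k : Type*} [Field k] {I : Ideal (MvPolynomial σ k)}
  (R : MinimalGradedFreeResolution I)

theorem betti_eq_zero_iff (i j : ℕ) : R.betti i j = 0 ↔ ∀ a, R.deg i a ≠ j := by
  simp [betti, Finset.filter_eq_empty_iff]

theorem coeff_zero_d (i : ℕ) (y) (b) : coeff 0 (R.d i y b) = 0 := by
  have h := apply_eq_sum_mul (LinearMap.proj b ∘ₗ R.d i) y
  simp only [LinearMap.coe_comp, Function.comp_apply, LinearMap.coe_proj, Function.eval] at h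
  rw [h, ← constantCoeff_eq, map_sum]
  refine Finset.sum_eq_zero fun a _ => ?_
  rw [map_mul]
  have := R.minimal i a b
  rw [← Set.image_univ, mem_ideal_span_X_image] at this
  have h0 : constantCoeff (R.d i (Pi.single a 1) b) = 0 := by
    rw [constantCoeff_eq]
    by_contra hne
    obtain ⟨x, -, hx⟩ := this 0 (mem_support_iff.2 hne)
    simp at hx
  rw [h0, mul_zero]

variable [Fintype σ] [LinearOrder σ]

/-- The cokernel of `R.d i` is resolved by the tail of `R` from $F_i$ on. Each shift trades one
homological degree for one step along the resolution, down to degree $0$. -/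
theorem koszulAcyclic_range_iff (p i j : ℕ) :
    KoszulAcyclic (R.deg i) (LinearMap.range (R.d i)) p j ↔ R.betti (i + p) j = 0 := by
  induction p generalizing i with
  | zero =>
    rw [koszulAcyclic_zero_iff, betti_eq_zero_iff]
    · rfl
    · rintro _ ⟨y, rfl⟩ a
      exact R.coeff_zero_d i y a
  | succ p ih =>
    rw [koszulAcyclic_range_iff_ker (R.d i) (R.d_homogeneous i) (R.coeff_zero_d i),
      (R.exact_d i).linearMap_ker_eq, ih, Nat.add_right_comm, Nat.add_assoc]

/-- The Betti numbers vanish exactly where the Koszul homology of `S / I` does. -/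
theorem betti_eq_zero_iff_koszulAcyclicQuotient
    (hI : ∀ f ∈ I, ∀ e m, degreePart e m f ∈ I) (p j : ℕ) :
    R.betti p j = 0 ↔ KoszulAcyclicQuotient I p j := by
  choose f hf hfa using R.aug_homogeneous
  set φ : (Fin (R.rank 0) → MvPolynomial σ k) →ₗ[MvPolynomial σ k] MvPolynomial σ k :=
    (Pi.basisFun (MvPolynomial σ k) (Fin (R.rank 0))).constr ℕ f with hφdef
  have hφ1 : ∀ a, φ (Pi.single a 1) = f a := fun a => by
    rw [hφdef, ← Pi.basisFun_apply, Module.Basis.constr_basis]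
  have hφ : I.mkQ ∘ₗ φ = R.aug := by
    refine (Pi.basisFun (MvPolynomial σ k) (Fin (R.rank 0))).ext fun a => ?_
    rw [Pi.basisFun_apply, LinearMap.comp_apply, hφ1, hfa]
    rfl
  have hker : Submodule.comap φ I = LinearMap.range (R.d 0) := by
    rw [← R.exact_aug.linearMap_ker_eq, ← hφ, LinearMap.ker_comp, Submodule.ker_mkQ]
  rw [koszulAcyclicQuotient_iff I hI φ (deg := R.deg 0), hker, koszulAcyclic_range_iff, zero_add]
  · intro a u hu
    rw [hφ1] at hu
    rw [add_zero]
    have := hf a (mem_support_iff.1 hu)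
    rwa [Finsupp.degree_eq_weight_one]
  · intro g
    obtain ⟨y, hy⟩ := R.aug_surjective (Ideal.Quotient.mk I g)
    refine ⟨y, ?_⟩
    rw [← hφ] at hy
    exact (Ideal.Quotient.mk_eq_mk_iff_sub_mem _ _).1 hy.symm

end MinimalGradedFreeResolution

/-! ### Complementary signs and squarefree monomials -/

theorem koszulSign_compl_mul {n : ℕ} (v : Fin n) (F : Finset (Fin n)) :
    koszulSign v Fᶜ * koszulSign v F = (-1) ^ (v : ℕ) := by
  rw [koszulSign, koszulSign, ← pow_add, ← Finset.card_union_of_disjoint, ← Finset.filter_union]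
  · have : Fᶜ ∪ F = Finset.univ := by rw [Finset.union_comm, Finset.union_compl]
    rw [this]
    rw [Finset.filter_gt_eq_Iio, Fin.card_Iio]
  · exact Finset.disjoint_filter_filter disjoint_compl_left

/-- The exponent of the squarefree monomial with support `F`. -/
noncomputable def squarefreeExponent {σ : Type*} (F : Finset σ) : σ →₀ ℕ :=
  Finsupp.indicator F fun _ _ => 1

section SquarefreeExponent

variable {σ : Type*} [DecidableEq σ]

theorem squarefreeExponent_apply (F : Finset σ) (v : σ) :
    squarefreeExponent F v = if v ∈ F then 1 else 0 := by
  simp [squarefreeExponent, Finsupp.indicator_apply]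

theorem support_squarefreeExponent (F : Finset σ) : (squarefreeExponent F).support = F := by
  ext v
  simp [squarefreeExponent_apply]

theorem squarefreeExponent_le_iff {F : Finset σ} {u : σ →₀ ℕ} :
    squarefreeExponent F ≤ u ↔ F ⊆ u.support := by
  constructor
  · intro h v hv
    have := h v
    rw [squarefreeExponent_apply, if_pos hv] at this
    rw [Finsupp.mem_support_iff]
    omega
  · intro h v
    rw [squarefreeExponent_apply]
    split_ifs with hv
    · exact Nat.one_le_iff_ne_zero.2 (Finsupp.mem_support_iff.1 (h hv))
    · exact Nat.zero_le _

theorem degree_squarefreeExponent (F : Finset σ) : (squarefreeExponent F).degree = F.card := by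
  rw [Finsupp.degree_apply, support_squarefreeExponent, Finset.card_eq_sum_ones]
  exact Finset.sum_congr rfl fun v hv => by rw [squarefreeExponent_apply, if_pos hv]

theorem prod_X_eq_monomial {k : Type*} [CommSemiring k] (F : Finset σ) :
    ∏ v ∈ F, (X v : MvPolynomial σ k) = monomial (squarefreeExponent F) 1 := by
  rw [monomial_eq, C_1, one_mul, Finsupp.prod, support_squarefreeExponent]
  exact Finset.prod_congr rfl fun v hv => by rw [squarefreeExponent_apply, if_pos hv, pow_one]

theorem squarefreeExponent_sub_single (F : Finset σ) (v : σ) :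
    squarefreeExponent F - Finsupp.single v 1 = squarefreeExponent (F.erase v) := by
  ext w
  simp only [Finsupp.coe_tsub, Pi.sub_apply, squarefreeExponent_apply, Finset.mem_erase,
    Finsupp.single_apply]
  by_cases h : v = w
  · subst h; simp; split_ifs <;> rfl
  · simp [h, Ne.symm h]

theorem X_mul_monomial_squarefreeExponent {k : Type*} [CommSemiring k] {F : Finset σ} {v : σ}
    (hv : v ∉ F) : (X v : MvPolynomial σ k) * monomial (squarefreeExponent F) 1 =
      monomial (squarefreeExponent (insert v F)) 1 := by
  rw [← prod_X_eq_monomial, ← prod_X_eq_monomial, Finset.prod_insert hv]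

end SquarefreeExponent

/-! ### The Stanley–Reisner ideal and squarefree multidegrees -/

namespace AbstractSimplicialComplex

variable {n : ℕ} (Δ : AbstractSimplicialComplex (Fin n))

theorem IsFace.subset {F G : Finset (Fin n)} (hF : Δ.IsFace F) (h : G ⊆ F) : Δ.IsFace G := by
  rcases G.eq_empty_or_nonempty with hG | hG
  · exact Or.inl hG
  rcases hF with rfl | hF
  · exact Or.inl (Finset.subset_empty.1 h)
  · exact Or.inr ((Δ.isRelLowerSet_faces hF).2 h hG)

theorem isFace_singleton (v : Fin n) : Δ.IsFace {v} := Or.inr (Δ.singleton_mem v)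

variable {Δ} in
theorem IsFace.card_le {d : ℕ} (hd : Δ.dim = (d : ℤ) - 1) {F : Finset (Fin n)}
    (hF : Δ.IsFace F) : F.card ≤ d := by
  classical
  have h := Finset.le_sup (f := Finset.card) (s := Finset.univ.filter Δ.IsFace) (b := F)
    (by simpa using hF)
  unfold dim at hd
  have : (Finset.univ.filter Δ.IsFace).sup Finset.card = d := by
    have : (((Finset.univ.filter Δ.IsFace).sup Finset.card : ℕ) : ℤ) = d := by
      convert sub_left_injective hd
    exact_mod_cast this
  omega

variable {k : Type*} [Field k]

theorem mem_stanleyReisnerIdeal_iff {f : MvPolynomial (Fin n) k} :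
    f ∈ Δ.stanleyReisnerIdeal k ↔ ∀ u, Δ.IsFace u.support → coeff u f = 0 := by
  have h : Δ.stanleyReisnerIdeal k = Ideal.span ((fun s => monomial s (1 : k)) ''
      (squarefreeExponent '' {F | ¬ Δ.IsFace F})) := by
    unfold stanleyReisnerIdeal
    congr 1
    ext p
    simp only [Set.mem_ofPred_eq, Set.mem_image, exists_exists_and_eq_and, prod_X_eq_monomial,
      @eq_comm _ p]
  rw [h, mem_ideal_span_monomial_image]
  constructor
  · intro H u hu
    by_contra hne
    obtain ⟨_, ⟨F, hF, rfl⟩, hle⟩ := H u (mem_support_iff.2 hne)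
    exact hF (hu.subset Δ (squarefreeExponent_le_iff.1 hle))
  · intro H u hu
    refine ⟨_, ⟨u.support, fun hf => mem_support_iff.1 hu (H u hf), rfl⟩, ?_⟩
    exact squarefreeExponent_le_iff.2 subset_rfl

theorem degreePart_mem_stanleyReisnerIdeal {f : MvPolynomial (Fin n) k}
    (hf : f ∈ Δ.stanleyReisnerIdeal k) (e m : ℕ) : degreePart e m f ∈ Δ.stanleyReisnerIdeal k := by
  rw [mem_stanleyReisnerIdeal_iff] at hf ⊢
  intro u hu
  rw [coeff_degreePart, hf u hu, ite_self]

/-- The bound $c=1$ matters: $x_v$ still divides every quotient monomial that is kept, so its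
support, which alone decides membership, is unchanged. -/
theorem divVar_mem_stanleyReisnerIdeal (v : Fin n) {f : MvPolynomial (Fin n) k}
    (hf : f ∈ Δ.stanleyReisnerIdeal k) : divVar 1 v f ∈ Δ.stanleyReisnerIdeal k := by
  rw [mem_stanleyReisnerIdeal_iff] at hf ⊢
  intro u hu
  rw [coeff_divVar]
  split_ifs with h
  · refine hf _ (hu.subset Δ fun w hw => ?_)
    rw [Finsupp.mem_support_iff] at hw ⊢
    by_cases hwv : w = v
    · subst hwv; omega
    · simpa [Ne.symm hwv, hwv] using hw
  · rfl

/-- The Koszul homology of the face ring lives in squarefree multidegrees. -/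
theorem koszulAcyclicQuotient_stanleyReisnerIdeal {d : ℕ} (hd : Δ.dim = (d : ℤ) - 1) {p j : ℕ}
    (h : n < j ∨ p + d < j) : KoszulAcyclicQuotient (Δ.stanleyReisnerIdeal k) p j := by
  intro z hz hdz
  obtain ⟨w, z', -, -, hzz', hc⟩ := exists_koszul_reduction 1 (Δ.stanleyReisnerIdeal k)
    (fun v f hf => Δ.divVar_mem_stanleyReisnerIdeal v hf) z hdz Finset.univ
  refine ⟨w, fun τ => ?_⟩
  have hz' : z' τ ∈ Δ.stanleyReisnerIdeal k := by
    rw [mem_stanleyReisnerIdeal_iff]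
    intro u hu
    rw [hc]
    split_ifs with hle
    · by_contra hne
      obtain ⟨h1, h2⟩ := hz τ u hne
      have h3 : u = squarefreeExponent u.support := by
        ext v
        rw [squarefreeExponent_apply]
        have := hle v (Finset.mem_univ v)
        unfold koszulDegree at this
        split_ifs with hv
        · rw [Finsupp.mem_support_iff] at hv; omega
        · simpa using hv
      have h4 : u.degree = u.support.card := by
        conv_lhs => rw [h3, degree_squarefreeExponent]
      have h5 : Disjoint u.support τ := by
        rw [Finset.disjoint_left]
        intro v hv hvτ
        have := hle v (Finset.mem_univ v)
        rw [koszulDegree, if_pos hvτ] at this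
        rw [Finsupp.mem_support_iff] at hv
        omega
      have h6 := Finset.card_le_univ (u.support ∪ τ)
      rw [Finset.card_union_of_disjoint h5, Fintype.card_fin] at h6
      have h7 := hu.card_le hd
      omega
    · rfl
  have := add_mem (hzz' τ) hz'
  rwa [sub_add_cancel] at this

theorem exists_cycle_of_nontrivial_reducedHomology {q : ℤ}
    (h : Nontrivial (Δ.ReducedHomology k q)) :
    ∃ c : Δ.FaceOfDim q → k, c ≠ 0 ∧ Δ.boundary k q (q - 1) c = 0 := by
  by_contra! H
  have hs : Subsingleton (LinearMap.ker (Δ.boundary k q (q - 1))) :=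
    ⟨fun a b => Subtype.ext (by
      have h1 : a.1 = 0 := by_contra fun h' => H _ h' a.2
      have h2 : b.1 = 0 := by_contra fun h' => H _ h' b.2
      rw [h1, h2])⟩
  exact not_subsingleton (Δ.ReducedHomology k q) (Submodule.Quotient.subsingleton_iff.2
    (Subsingleton.elim _ _))

end AbstractSimplicialComplex

/-! ### Nonvanishing from top cycles and from disconnected subgraphs -/

namespace AbstractSimplicialComplex

variable {n : ℕ} (Δ : AbstractSimplicialComplex (Fin n)) {k : Type*} [Field k]

/-- A nonzero simplicial cycle, extended by zero to all sets of vertices. -/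
theorem exists_cycle_extension {d : ℕ} (h : Nontrivial (Δ.ReducedHomology k ((d : ℤ) - 1))) :
    ∃ c : Finset (Fin n) → k, (∃ F, c F ≠ 0) ∧ (∀ F, c F ≠ 0 → Δ.IsFace F ∧ F.card = d) ∧
      ∀ G, ∑ v ∈ Gᶜ, koszulSign v G • c (insert v G) = 0 := by
  classical
  obtain ⟨c, hc, hb⟩ := Δ.exists_cycle_of_nontrivial_reducedHomology h
  let C : Finset (Fin n) → k := fun F =>
    if hF : Δ.IsFace F ∧ (F.card : ℤ) = ((d : ℤ) - 1) + 1 then c ⟨F, hF⟩ else 0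
  have hC : ∀ F, C F ≠ 0 → Δ.IsFace F ∧ F.card = d := by
    intro F hF
    by_cases h : Δ.IsFace F ∧ (F.card : ℤ) = ((d : ℤ) - 1) + 1
    · exact ⟨h.1, by omega⟩
    · exact absurd (dif_neg h) hF
  have hCc : ∀ F : Δ.FaceOfDim ((d : ℤ) - 1), c F = C F.1 := fun F => by
    simp only [C]
    rw [dif_pos F.2]
    rfl
  refine ⟨C, ?_, hC, fun G => ?_⟩
  · obtain ⟨F, hF⟩ := Function.ne_iff.1 hc
    exact ⟨F.1, by rw [← hCc]; exact hF⟩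
  by_cases hG : Δ.IsFace G ∧ (G.card : ℤ) = ((d : ℤ) - 1 - 1) + 1
  · have h1 := congrFun hb ⟨G, hG⟩
    let := Fintype.ofFinite (Δ.FaceOfDim ((d : ℤ) - 1))
    change ∑ F : Δ.FaceOfDim ((d : ℤ) - 1), incidence k F.1 G * c F = 0 at h1
    rw [Fintype.sum_of_injective (fun F : Δ.FaceOfDim ((d : ℤ) - 1) => F.1)
      Subtype.val_injective _ (fun F => incidence k F G * C F)] at h1
    · rw [← h1]
      simp only [incidence, Finset.sum_mul]
      rw [Finset.sum_sigma']
      refine Finset.sum_nbij' (fun v => ⟨insert v G, v⟩) (fun p => p.2) ?_ ?_ ?_ ?_ ?_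
      · intro v hv
        simpa using Finset.erase_insert (Finset.mem_compl.1 hv)
      · rintro ⟨F, v⟩ hp
        simp only [Finset.mem_sigma, Finset.mem_univ, Finset.mem_filter, true_and] at hp
        simp [← hp.2]
      · intro v _
        rfl
      · rintro ⟨F, v⟩ hp
        simp only [Finset.mem_sigma, Finset.mem_univ, Finset.mem_filter, true_and] at hp
        simp only [← hp.2, Finset.insert_erase hp.1]
      · intro v hv
        simp only [koszulSign, Finset.filter_insert, lt_self_iff_false, if_false, zsmul_eq_mul]
        push_cast
        rfl
    · intro F hF
      rw [show C F = 0 from dif_neg fun h => hF ⟨⟨F, h⟩, rfl⟩, mul_zero]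
    · intro F
      rw [hCc]
  · refine Finset.sum_eq_zero fun v hv => ?_
    have : C (insert v G) = 0 := by
      by_contra hne
      obtain ⟨h1, h2⟩ := hC _ hne
      rw [Finset.card_insert_of_notMem (Finset.mem_compl.1 hv)] at h2
      exact hG ⟨h1.subset Δ (Finset.subset_insert _ _), by omega⟩
    rw [this, smul_zero]

/-- Top homology gives a nonzero Betti number in the last column of the last row. -/
theorem not_koszulAcyclicQuotient_of_nontrivial_reducedHomology {d : ℕ}
    (hd : Δ.dim = (d : ℤ) - 1) (h : Nontrivial (Δ.ReducedHomology k ((d : ℤ) - 1))) :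
    ¬ KoszulAcyclicQuotient (Δ.stanleyReisnerIdeal k) (n - d) n := by
  classical
  obtain ⟨c, ⟨F₀, hF₀⟩, hc, hcyc⟩ := Δ.exists_cycle_extension h
  obtain ⟨hface, hcard⟩ := hc F₀ hF₀
  have hdn : d ≤ n := by
    have := F₀.card_le_univ
    rwa [hcard, Fintype.card_fin] at this
  intro H
  -- The chain $x_{F_0}e_{F_0^c}$ is a cycle modulo $I_\Delta$: any $F_0\cup\{v\}$ with $v\notin
  -- F_0$ has $d+1$ vertices and is no face.
  set z : Finset (Fin n) → MvPolynomial (Fin n) k :=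
    fun τ => if τ = F₀ᶜ then monomial (squarefreeExponent F₀) 1 else 0 with hz
  obtain ⟨w, hw⟩ := H z (by
    intro τ u hu
    simp only [hz] at hu
    split_ifs at hu with hτ
    · rw [coeff_monomial] at hu
      split_ifs at hu with hu'
      · rw [hτ, ← hu', degree_squarefreeExponent, Finset.card_compl, Fintype.card_fin]
        omega
      · exact absurd rfl hu
    · exact absurd rfl hu) (by
    intro τ
    refine Submodule.sum_mem _ fun v _ => zsmul_mem ?_ _
    simp only [hz]
    split_ifs with hτ
    · have hv : v ∉ F₀ := by
        rw [← Finset.mem_compl, ← hτ]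
        exact Finset.mem_insert_self _ _
      rw [smul_eq_mul, X_mul_monomial_squarefreeExponent hv, ← prod_X_eq_monomial]
      refine Ideal.subset_span ⟨_, fun hf => ?_, rfl⟩
      have := hf.card_le hd
      rw [Finset.card_insert_of_notMem hv] at this
      omega
    · rw [smul_zero]
      exact Submodule.zero_mem _)
  -- These signs convert the Koszul signs at complements into simplicial incidence signs.
  let ε : Finset (Fin n) → ℤ := fun F => ∏ u ∈ F, (-1) ^ (u : ℕ)
  have hε : ∀ G v, v ∉ G → ε (insert v G) * koszulSign v (insert v G)ᶜ =
      ε G * koszulSign v G := by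
    intro G v hv
    have h1 := koszulSign_compl_mul v (insert v G)
    have h2 : koszulSign v (insert v G) = koszulSign v G := by
      rw [koszulSign_insert hv, if_neg (lt_irrefl v), one_mul]
    have h3 : ((-1 : ℤ) ^ (v : ℕ)) * (-1) ^ (v : ℕ) = 1 := by rw [← mul_pow]; simp
    have h4 := koszulSign_mul_self v G
    rw [h2] at h1
    have h5 : koszulSign v (insert v G)ᶜ = (-1) ^ (v : ℕ) * koszulSign v G := by
      rw [← h1, mul_assoc, h4, mul_one]
    simp only [ε, Finset.prod_insert hv, h5]
    linear_combination (∏ u ∈ G, (-1 : ℤ) ^ (u : ℕ)) * koszulSign v G * h3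
  -- Pairing $c$ with $dw$ equals, after reindexing by $(F,v)\mapsto(F\setminus v,v)$, pairing
  -- $\partial c=0$ with $w$. The same pairing on $z$ will be $\pm c(F_0)\neq0$.
  have hbd : ∑ F, ε F • (c F * coeff (squarefreeExponent F) (koszulD _ k _ w Fᶜ)) = 0 := by
    have h1 : ∀ F, ε F • (c F * coeff (squarefreeExponent F) (koszulD _ k _ w Fᶜ)) =
        ∑ v ∈ F, (ε F * koszulSign v Fᶜ) •
          (c F * coeff (squarefreeExponent (F.erase v)) (w (F.erase v)ᶜ)) := by
      intro F
      rw [koszulD_apply, compl_compl, coeff_sum, Finset.mul_sum, Finset.smul_sum]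
      refine Finset.sum_congr rfl fun v hv => ?_
      rw [coeff_smul, smul_eq_mul, coeff_X_mul', support_squarefreeExponent, if_pos hv,
        squarefreeExponent_sub_single, mul_smul_comm, smul_smul, Finset.compl_erase]
    have h2 : ∀ G, ∑ v ∈ Gᶜ, (ε G * koszulSign v G) •
          (c (insert v G) * coeff (squarefreeExponent G) (w Gᶜ)) = 0 := by
      intro G
      have := congrArg (fun x => ε G • (x * coeff (squarefreeExponent G) (w Gᶜ))) (hcyc G)
      simp only [zero_mul, smul_zero, Finset.sum_mul, Finset.smul_sum, smul_mul_assoc,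
        smul_smul] at this
      exact this
    rw [← Finset.sum_eq_zero (s := Finset.univ) fun G _ => h2 G]
    simp only [h1]
    rw [Finset.sum_sigma', Finset.sum_sigma']
    refine Finset.sum_nbij' (fun p => ⟨p.1.erase p.2, p.2⟩) (fun p => ⟨insert p.2 p.1, p.2⟩)
      ?_ ?_ ?_ ?_ ?_
    · rintro ⟨F, v⟩ _
      simp
    · rintro ⟨G, v⟩ _
      simp
    · rintro ⟨F, v⟩ hp
      simp only [Finset.mem_sigma, Finset.mem_univ, true_and] at hp
      simp only [Finset.insert_erase hp]
    · rintro ⟨G, v⟩ hp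
      simp only [Finset.mem_sigma, Finset.mem_univ, true_and, Finset.mem_compl] at hp
      simp only [Finset.erase_insert hp]
    · rintro ⟨F, v⟩ hp
      simp only [Finset.mem_sigma, Finset.mem_univ, true_and] at hp
      have := hε (F.erase v) v (by simp)
      simp only [Finset.insert_erase hp] at this ⊢
      rw [this]
  have hzero : ∀ F, c F * coeff (squarefreeExponent F) (z Fᶜ) =
      c F * coeff (squarefreeExponent F) (koszulD _ k _ w Fᶜ) := by
    intro F
    by_cases hF : c F = 0
    · rw [hF, zero_mul, zero_mul]
    · have := (mem_stanleyReisnerIdeal_iff Δ).1 (hw Fᶜ) (squarefreeExponent F)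
        (by rw [support_squarefreeExponent]; exact (hc F hF).1)
      rw [coeff_sub, sub_eq_zero] at this
      rw [this]
  simp only [← hzero] at hbd
  rw [Finset.sum_eq_single F₀] at hbd
  · simp only [hz, if_true, coeff_monomial, mul_one] at hbd
    have hunit : IsUnit (ε F₀) := by
      simp only [ε]
      rw [Finset.prod_pow_eq_pow_sum]
      exact (isUnit_one.neg).pow _
    rcases Int.isUnit_iff.1 hunit with h' | h' <;> rw [h'] at hbd <;> simp [hF₀] at hbd
  · intro F _ hF
    have : Fᶜ ≠ F₀ᶜ := fun e => hF (compl_injective e)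
    simp [hz, this]
  · simp

/-- The term $x_ve_{U\setminus v}$ of a boundary can come only from a constant multiple of $e_U$. -/
theorem coeff_single_koszulD_erase {σ k : Type*} [Fintype σ] [LinearOrder σ] [CommRing k]
    {U : Finset σ} {v : σ} (hv : v ∈ U) (w : Finset σ → MvPolynomial σ k) :
    coeff (Finsupp.single v 1) (koszulD σ k _ w (U.erase v)) =
      koszulSign v (U.erase v) • coeff 0 (w U) := by
  rw [koszulD_apply, coeff_sum, Finset.sum_eq_single v]
  · rw [coeff_smul, smul_eq_mul, coeff_X_mul', if_pos (by simp), tsub_self,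
      Finset.insert_erase hv]
  · intro u _ hu
    rw [coeff_smul, smul_eq_mul, coeff_X_mul',
      if_neg (by simpa [Finsupp.single_apply, eq_comm] using hu),
      smul_zero]
  · simp

/-- A disconnected induced subcomplex on `p + 1` vertices gives a nonzero Betti number in the
linear strand. -/
theorem not_koszulAcyclicQuotient_of_disconnected {U A : Finset (Fin n)} {p : ℕ}
    (hU : U.card = p + 1) {a b : Fin n} (haU : a ∈ U) (hbU : b ∈ U) (ha : a ∈ A) (hb : b ∉ A)
    (hAU : ∀ x ∈ U, ∀ y ∈ U, x ∈ A → y ∉ A → ¬ Δ.IsFace {x, y}) :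
    ¬ KoszulAcyclicQuotient (Δ.stanleyReisnerIdeal k) p (p + 1) := by
  classical
  intro H
  -- With `E` the basis element $e_U$, the cycle used is the part $\sum_{v\in U\cap A}\pm
  -- x_ve_{U\setminus v}$ of $de_U$; the map `ψ` below extracts it by killing the variables outside
  -- $A$.
  let E : Finset (Fin n) → MvPolynomial (Fin n) k := fun τ => if τ = U then 1 else 0
  have hE : ∀ v ∈ U, koszulD _ k _ E (U.erase v) = koszulSign v (U.erase v) • X v := by
    intro v hv
    rw [koszulD_apply, Finset.sum_eq_single v]
    · rw [Finset.insert_erase hv]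
      simp [E]
    · intro u hu huv
      have : insert u (U.erase v) ≠ U := fun e => by
        have : v ∈ insert u (U.erase v) := by rw [e]; exact hv
        simp [huv.symm] at this
      simp [E, this]
    · simp
  have hE' : ∀ τ, koszulD _ k _ E τ ≠ 0 → ∃ v ∈ U, τ = U.erase v := by
    intro τ hτ
    obtain ⟨v, hv, hne⟩ := Finset.exists_ne_zero_of_sum_ne_zero hτ
    have : insert v τ = U := by
      by_contra h
      simp [E, h] at hne
    exact ⟨v, this ▸ Finset.mem_insert_self _ _,
      by rw [← this, Finset.erase_insert (Finset.mem_compl.1 hv)]⟩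
  let ψ : MvPolynomial (Fin n) k →ₐ[k] MvPolynomial (Fin n) k :=
    aeval fun v => if v ∈ A then X v else 0
  have hψ : ∀ v, ψ (X v) = if v ∈ A then X v else 0 := fun v => aeval_X _ _
  have hz1 : ∀ v ∈ U, ψ (koszulD _ k _ E (U.erase v)) =
      koszulSign v (U.erase v) • if v ∈ A then X v else 0 := by
    intro v hv
    rw [hE v hv, map_zsmul, hψ]
  obtain ⟨w, hw⟩ := H (fun τ => ψ (koszulD _ k _ E τ)) (by
    intro τ u hu
    replace hu : coeff u (ψ (koszulD _ k _ E τ)) ≠ 0 := hu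
    obtain ⟨v, hv, rfl⟩ := hE' τ fun h0 => hu (by rw [h0, map_zero, coeff_zero])
    rw [hz1 v hv, coeff_smul] at hu
    have hu := right_ne_zero_of_smul hu
    split_ifs at hu
    · rw [coeff_X] at hu
      split_ifs at hu with h
      · rw [← h, Finsupp.degree_single, Finset.card_erase_of_mem hv]
        omega
      · exact absurd rfl hu
    · exact absurd rfl hu) (by
    intro τ
    have h1 : ψ (koszulD _ k _ (koszulD _ k _ E) τ) = 0 := by
      rw [koszulD_koszulD, Pi.zero_apply, map_zero]
    -- Since $\psi(d^2e_U)=0$, only the failure of $\psi$ to commute with $d$ remains. It consists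
    -- of products $x_xx_v$ with $x\in A$, $v\notin A$, which are non-faces.
    rw [← sub_zero (koszulD _ k _ (fun τ => ψ (koszulD _ k _ E τ)) τ), ← h1,
      koszulD_apply (koszulD _ k _ E), map_sum, koszulD_apply, ← Finset.sum_sub_distrib]
    refine Submodule.sum_mem _ fun v hv => ?_
    rw [map_zsmul, ← smul_sub]
    refine zsmul_mem ?_ _
    rw [smul_eq_mul, smul_eq_mul, map_mul, hψ]
    by_cases hvA : v ∈ A
    · rw [if_pos hvA, sub_self]
      exact Submodule.zero_mem _
    · rw [if_neg hvA, zero_mul, sub_zero]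
      by_cases h0 : koszulD _ k _ E (insert v τ) = 0
      · rw [h0, map_zero, mul_zero]
        exact Submodule.zero_mem _
      · obtain ⟨x, hx, he⟩ := hE' _ h0
        rw [he, hz1 x hx, mul_smul_comm]
        refine zsmul_mem ?_ _
        split_ifs with hxA
        · have hvU : v ∈ U := Finset.mem_of_mem_erase (he ▸ Finset.mem_insert_self v τ)
          refine Ideal.subset_span ⟨{x, v}, hAU x hx v hvU hxA hvA, ?_⟩
          rw [Finset.prod_pair (ne_of_mem_of_not_mem hxA hvA), mul_comm]
        · rw [mul_zero]
          exact Submodule.zero_mem _)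
  -- Single vertices are faces, so linear coefficients survive modulo $I_\Delta$. The constant
  -- coefficient of $w$ at $U$ must then be $1$ by $a$ and $0$ by $b$.
  have key : ∀ v ∈ U, koszulSign v (U.erase v) • coeff 0 (w U) =
      koszulSign v (U.erase v) • if v ∈ A then 1 else 0 := by
    intro v hv
    have h1 := (mem_stanleyReisnerIdeal_iff Δ).1 (hw (U.erase v)) (Finsupp.single v 1) (by
      rw [show (Finsupp.single v 1 : Fin n →₀ ℕ).support = {v} from
        Finsupp.support_single v one_ne_zero]
      exact Δ.isFace_singleton v)
    rw [coeff_sub, sub_eq_zero, hz1 v hv, coeff_single_koszulD_erase hv, coeff_smul] at h1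
    rw [← h1]
    split_ifs <;> simp
  have key' : ∀ v ∈ U, coeff 0 (w U) = if v ∈ A then 1 else 0 := by
    intro v hv
    have := congrArg (fun x => koszulSign v (U.erase v) • x) (key v hv)
    simpa only [smul_smul, koszulSign_mul_self, one_smul] using this
  have h1 := key' a haU
  rw [key' b hbU, if_pos ha, if_neg hb] at h1
  exact zero_ne_one h1

end AbstractSimplicialComplex

theorem AbstractSimplicialComplex.le_card_of_nontrivial_reducedHomology {n : ℕ} {k : Type*}
    [Field k] (Δ : AbstractSimplicialComplex (Fin n)) {d : ℕ}
    (h : Nontrivial (Δ.ReducedHomology k ((d : ℤ) - 1))) : d ≤ n := by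
  obtain ⟨c, ⟨F, hF⟩, hc, -⟩ := Δ.exists_cycle_extension h
  have := F.card_le_univ
  rwa [(hc F hF).2, Fintype.card_fin] at this

/-! ### Regularity and the last row of the Betti table -/

namespace MinimalGradedFreeResolution

variable {n : ℕ} {k : Type*} [Field k] {Δ : AbstractSimplicialComplex (Fin n)}
  (R : MinimalGradedFreeResolution (Δ.stanleyReisnerIdeal k))

theorem betti_stanleyReisnerIdeal_eq_zero_iff (p j : ℕ) :
    R.betti p j = 0 ↔ KoszulAcyclicQuotient (Δ.stanleyReisnerIdeal k) p j :=
  R.betti_eq_zero_iff_koszulAcyclicQuotient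
    (fun _ hf e m => Δ.degreePart_mem_stanleyReisnerIdeal hf e m) p j

theorem deg_le {d : ℕ} (hd : Δ.dim = (d : ℤ) - 1) (i : ℕ) (a : Fin (R.rank i)) :
    R.deg i a ≤ n ∧ R.deg i a ≤ i + d := by
  by_contra h
  have h1 := (R.betti_stanleyReisnerIdeal_eq_zero_iff i (R.deg i a)).2
    (Δ.koszulAcyclicQuotient_stanleyReisnerIdeal hd (by omega))
  exact (R.betti_eq_zero_iff _ _).1 h1 a rfl

theorem exists_deg_eq_of_betti_ne_zero {i : ℕ} {j : ℤ} (h : R.betti i j ≠ 0) :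
    ∃ a, (R.deg i a : ℤ) = j := by
  by_contra! H
  exact h (by simp [betti, H])

theorem le_maxDegree (i : ℕ) (a : Fin (R.rank i)) :
    ((R.deg i a : ℤ) : WithBot ℤ) ≤ R.maxDegree i :=
  Finset.le_sup (f := fun a => ((R.deg i a : ℤ) : WithBot ℤ)) (Finset.mem_univ a)

theorem maxDegree_le {d : ℕ} (hd : Δ.dim = (d : ℤ) - 1) (i : ℕ) :
    R.maxDegree i ≤ ((d + i : ℤ) : WithBot ℤ) :=
  Finset.sup_le fun a _ => WithBot.coe_le_coe.2 (by have := (R.deg_le hd i a).2; omega)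

theorem exists_deg_eq_of_nontrivial_reducedHomology {d : ℕ} (hd : Δ.dim = (d : ℤ) - 1)
    (h : Nontrivial (Δ.ReducedHomology k ((d : ℤ) - 1))) : ∃ a, R.deg (n - d) a = n := by
  by_contra! H
  exact Δ.not_koszulAcyclicQuotient_of_nontrivial_reducedHomology hd h
    ((R.betti_stanleyReisnerIdeal_eq_zero_iff _ _).1 ((R.betti_eq_zero_iff _ _).2 H))

/-- The entry $b_{n-d,n}$ attains the bound $t_i\le i+d$. -/
theorem regularity_eq {d : ℕ} (hd : Δ.dim = (d : ℤ) - 1)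
    (h : Nontrivial (Δ.ReducedHomology k ((d : ℤ) - 1))) : R.regularity = d := by
  obtain ⟨a, ha⟩ := R.exists_deg_eq_of_nontrivial_reducedHomology hd h
  have hdn := Δ.le_card_of_nontrivial_reducedHomology h
  refine IsGreatest.csSup_eq ⟨⟨n - d, le_antisymm (R.maxDegree_le hd _) ?_⟩, ?_⟩
  · refine le_trans (WithBot.coe_le_coe.2 ?_) (R.le_maxDegree (n - d) a)
    omega
  · rintro q ⟨i, hi⟩
    have := R.maxDegree_le hd i
    rw [hi, WithBot.coe_le_coe] at this
    omega

/-- In row $d$ the internal degree in column $i$ is $i+d$, which cannot exceed $n$. -/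
theorem lp_regularity_eq {d : ℕ} (hd : Δ.dim = (d : ℤ) - 1)
    (h : Nontrivial (Δ.ReducedHomology k ((d : ℤ) - 1))) : R.lp (R.regularity + 1) = n - d := by
  obtain ⟨a, ha⟩ := R.exists_deg_eq_of_nontrivial_reducedHomology hd h
  have hdn := Δ.le_card_of_nontrivial_reducedHomology h
  rw [R.regularity_eq hd h]
  refine IsGreatest.csSup_eq ⟨?_, ?_⟩
  · have h1 : R.betti (n - d) (n : ℕ) ≠ 0 := fun h0 => (R.betti_eq_zero_iff _ _).1 h0 a ha
    have h2 : (((n - d : ℕ) : ℤ) + ((d : ℤ) + 1) - 1) = (n : ℕ) := by omega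
    rw [Set.mem_ofPred_eq, h2]
    exact h1
  · intro i hi
    obtain ⟨b, hb⟩ := R.exists_deg_eq_of_betti_ne_zero hi
    have := (R.deg_le hd i b).1
    omega

theorem le_lp_two {d : ℕ} (hd : Δ.dim = (d : ℤ) - 1) {i : ℕ} (hi : R.betti i (i + 1) ≠ 0) :
    i ≤ R.lp 2 := by
  refine le_csSup ⟨n, fun q hq => ?_⟩ ?_
  · obtain ⟨b, hb⟩ := R.exists_deg_eq_of_betti_ne_zero hq
    have := (R.deg_le hd q b).1
    omega
  · rw [Set.mem_ofPred_eq, show (i : ℤ) + 2 - 1 = i + 1 by ring]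
    exact hi

end MinimalGradedFreeResolution

/-! ### Separating sets and the connectivity bound -/

theorem SimpleGraph.exists_separation_of_not_connected {V : Type*} {G : SimpleGraph V} {s : Set V}
    (hs : s.Nonempty) (h : ¬ (G.induce s).Connected) :
    ∃ A : Set V, ∃ a ∈ s, ∃ b ∈ s, a ∈ A ∧ b ∉ A ∧
      ∀ x ∈ s, ∀ y ∈ s, x ∈ A → y ∉ A → ¬ G.Adj x y := by
  have := hs.to_subtype
  have h' : ¬ (G.induce s).Preconnected := fun hp => h ⟨hp⟩
  simp only [SimpleGraph.Preconnected, not_forall] at h'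
  obtain ⟨a, b, hab⟩ := h'
  refine ⟨{x | ∃ hx : x ∈ s, (G.induce s).Reachable a ⟨x, hx⟩}, a, a.2, b, b.2,
    ⟨a.2, SimpleGraph.Reachable.refl _⟩, fun ⟨_, h⟩ => hab h, ?_⟩
  rintro x hx y hy ⟨_, hax⟩ hyA hxy
  have : (G.induce s).Adj ⟨x, hx⟩ ⟨y, hy⟩ := hxy
  exact hyA ⟨hy, hax.trans this.reachable⟩

theorem mainTheorem3 {k : Type*} [Field k] {n : ℕ} (Δ : AbstractSimplicialComplex (Fin n))
    (d s : ℕ) (hdim : Δ.dim = (d : ℤ) - 1)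
    (htop : Nontrivial (Δ.ReducedHomology k ((d : ℤ) - 1)))
    (R : MinimalGradedFreeResolution (Δ.stanleyReisnerIdeal k))
    (hA : R.PropertyA) (hB : R.PropertyB s) :
    Δ.underlyingGraph.IsVertexConnected (d + s - 1) := by
  classical
  have hdn := Δ.le_card_of_nontrivial_reducedHomology htop
  have hreg := R.regularity_eq hdim htop
  have hlp := R.lp_regularity_eq hdim htop
  obtain ⟨hA1, hA2⟩ := hA
  rw [hlp] at hA1 hA2
  rw [hreg] at hA2
  have hB' : ∀ i, ∀ a : Fin (R.rank i), d + i ≤ R.deg i a + 1 → s ≤ i := by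
    intro i a ha
    by_contra! hi
    have := (R.le_maxDegree i a).trans_lt (hB i hi)
    rw [WithBot.coe_lt_coe, hreg] at this
    omega
  -- Apply $\mathfrak B_s$ to the corner $b_{n-d,n}$. This gives $d+s-1\le n$ and leaves a vertex
  -- outside $W$.
  have hs : s ≤ n - d := by
    obtain ⟨a, ha⟩ := R.exists_deg_eq_of_nontrivial_reducedHomology hdim htop
    exact hB' _ a (by omega)
  refine ⟨by rw [Fintype.card_fin]; omega, fun W hW => ?_⟩
  by_contra hcon
  have hcard : Wᶜ.card = n - W.card := by rw [Finset.card_compl, Fintype.card_fin]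
  have hne : ({v | v ∉ W} : Set (Fin n)).Nonempty := by
    obtain ⟨v, hv⟩ := Finset.card_pos.1 (show 0 < Wᶜ.card by omega)
    exact ⟨v, Finset.mem_compl.1 hv⟩
  obtain ⟨A, a, ha, b, hb, haA, hbA, hsep⟩ :=
    SimpleGraph.exists_separation_of_not_connected hne hcon
  obtain ⟨p, hp⟩ : ∃ p, Wᶜ.card = p + 1 := ⟨Wᶜ.card - 1, by omega⟩
  have hbetti : R.betti p (p + 1) ≠ 0 := by
    have := mt (R.betti_stanleyReisnerIdeal_eq_zero_iff p (p + 1)).1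
      (Δ.not_koszulAcyclicQuotient_of_disconnected (A := A.toFinset) hp
        (Finset.mem_compl.2 ha) (Finset.mem_compl.2 hb) (by simpa using haA) (by simpa using hbA)
        (fun x hx y hy hxA hyA hface => hsep x (Finset.mem_compl.1 hx) y (Finset.mem_compl.1 hy)
          (by simpa using hxA) (by simpa using hyA)
          ⟨ne_of_mem_of_not_mem hxA hyA, hface⟩))
    exact_mod_cast this
  have hpm : p ≤ n - d := (R.le_lp_two hdim hbetti).trans hA1
  -- The bound `hpm`, from the first half of $\mathfrak A$, makes $n-d-p$ a genuine difference, so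
  -- that the inequality in its second half applies.
  have h1 := hA2 (n - d - p) p (by omega)
  obtain ⟨c, hc⟩ := R.exists_deg_eq_of_betti_ne_zero (ne_of_gt (lt_of_lt_of_le
    (Nat.pos_of_ne_zero hbetti) h1))
  have h2 := hB' _ c (by omega)
  omega
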